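/- Let $\mathbb{D}=\{z\in\mathbb{C}:|z|<1\}$ and let $\mathcal{S}$ be the class of analytic univalent functions $f$ on $\mathbb{D}$ with $f(0)=0$, $f'(0)=1$. For analytic $p,\varphi$ on $\mathbb{D}$, write $p\prec\varphi$ if $p=\varphi\circ\omega$ for some analytic $\omega:\mathbb{D}\to\mathbb{D}$ with $\omega(0)=0$. Let $\mathcal{S}^*(\varphi)$ be the class of all $f\in\mathcal{S}$ with $zf'(z)/f(z)\prec\varphi(z)$, where $zf'(z)/f(z)$ is given its limit value $1$ at $z=0$, and let $\mathcal{S}^*_{car}=\mathcal{S}^*(1+z+z^2/2)$. The $\mathcal{S}^*_{car}$-radius of a class $\mathcal{M}\subset\mathcal{S}$ is the largest $R\in(0,1]$ such that $z\mapsto f(rz)/r$ belongs to $\mathcal{S}^*_{car}$ for all $f\in\mathcal{M}$ and all $0<r\le R$. It is called sharp if there is a single $f\in\mathcal{M}$ such that $z\mapsto f(rz)/r$ is not in $\mathcal{S}^*_{car}$ for any $r\in(R,1]$. All square roots are principal. The following are the $\mathcal{S}^*_{car}$-radii of the indicated classes, and all of them are sharp. (a) $\mathcal{S}^*(\sqrt{1+cz})$,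 $\tfrac34<c\le1$: $\;r_1=\dfrac{3}{4c}$. (b) $\mathcal{S}^*_L(\alpha)=\mathcal{S}^*(\alpha+(1-\alpha)\sqrt{1+z})$, $0\le\alpha<\tfrac12$: $\;r_2=\dfrac{3-4\alpha}{4(1-\alpha)^2}$. (c) $\mathcal{S}^*_e(\alpha)=\mathcal{S}^*(\alpha+(1-\alpha)e^z)$, $0\le\alpha<\dfrac{e-2}{2(e-1)}$: $\;r_3=\log\left(\dfrac{2(1-\alpha)}{1-2\alpha}\right)$. (d) $\mathcal{S}^*_{RL}=\mathcal{S}^*\left(\sqrt2-(\sqrt2-1)\sqrt{\dfrac{1-z}{1+2(\sqrt2-1)z}}\right)$: $\;r_4=\dfrac{39+17\sqrt2}{82}$. (e) $\mathcal{S}^*_C=\mathcal{S}^*(1+4z/3+2z^2/3)$: $\;r_5=\tfrac12$. (f) $\mathcal{S}^*_{lim}=\mathcal{S}^*(1+\sqrt2\,z+z^2/2)$: $\;r_6=\sqrt2-1$. (g) The crescent class $\mathcal{S}^*(z+\sqrt{1+z^2})$: $\;r_7=\tfrac34$. (h) $\mathcal{S}^*_{sin}=\mathcal{S}^*(1+\sin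 z)$: $\;r_8=\arcsin\left(\tfrac12\right)$. (i) $\mathcal{S}^*_{ne}=\mathcal{S}^*(1+z-z^3/3)$: $\;r_9$, the smallest root of $2r^3-6r+3=0$ in $(0,1)$; it satisfies $|r_9-0.557875|<10^{-6}$. -/

import Mathlib

open Complex

noncomputable section

namespace CarRadius

/-- The open unit disk. -/
def unitDisk : Set ℂ := Metric.ball 0 1

/-- The class `𝒮` of normalized univalent functions: `f` is holomorphic and injective on the unit
disk with `f 0 = 0` and `f' 0 = 1`. Values outside the disk are irrelevant. -/
structure IsNormalizedUnivalent (f : ℂ → ℂ) : Prop where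
  differentiableOn : DifferentiableOn ℂ f unitDisk
  map_zero : f 0 = 0
  deriv_zero : deriv f 0 = 1
  injOn : Set.InjOn f unitDisk

/-- Subordination `p ≺ φ` on the unit disk: `p = φ ∘ ω` on the disk for some holomorphic self-map
`ω` of the disk fixing the origin. -/
def Subordinate (p φ : ℂ → ℂ) : Prop :=
  ∃ ω : ℂ → ℂ, DifferentiableOn ℂ ω unitDisk ∧ Set.MapsTo ω unitDisk unitDisk ∧ ω 0 = 0 ∧
    ∀ z ∈ unitDisk, p z = φ (ω z)

/-- The function `z f'(z) / f(z)`, with its removable singularity at `0` filled in (for a function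
in `𝒮` the value there is `1`, and `f` has no other zero in the disk). -/
def starQuotient (f : ℂ → ℂ) (z : ℂ) : ℂ :=
  if z = 0 then 1 else z * deriv f z / f z

/-- The Ma–Minda class `𝒮*(φ)`. -/
def starClass (φ : ℂ → ℂ) : Set (ℂ → ℂ) :=
  {f | IsNormalizedUnivalent f ∧ Subordinate (starQuotient f) φ}

/-- The cardioid function `φ_car`. -/
def phiCar (z : ℂ) : ℂ := 1 + z + z ^ 2 / 2

/-- The class `𝒮*_car`. -/
def starCar : Set (ℂ → ℂ) := starClass phiCar

/-- The principal square root. -/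
def csqrt (z : ℂ) : ℂ := z ^ (1 / 2 : ℂ)

/-- `√(1 + c z)`, right loop of a Cassinian oval. -/
def psiCassini (c : ℝ) (z : ℂ) : ℂ := csqrt (1 + c * z)

/-- `α + (1 - α) √(1 + z)`. -/
def psiL (α : ℝ) (z : ℂ) : ℂ := α + (1 - α) * csqrt (1 + z)

/-- `α + (1 - α) e^z`. -/
def psiE (α : ℝ) (z : ℂ) : ℂ := α + (1 - α) * exp z

/-- `√2 - (√2 - 1) √((1 - z) / (1 + 2 (√2 - 1) z))`. -/
def psiRL (z : ℂ) : ℂ :=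
  (√2 : ℝ) - ((√2 : ℝ) - 1) * csqrt ((1 - z) / (1 + 2 * ((√2 : ℝ) - 1) * z))

/-- `1 + 4 z / 3 + 2 z² / 3`. -/
def psiC (z : ℂ) : ℂ := 1 + 4 * z / 3 + 2 * z ^ 2 / 3

/-- `1 + √2 z + z² / 2`. -/
def psiLim (z : ℂ) : ℂ := 1 + (√2 : ℝ) * z + z ^ 2 / 2

/-- `z + √(1 + z²)`. -/
def psiCrescent (z : ℂ) : ℂ := z + csqrt (1 + z ^ 2)

/-- `1 + sin z`. -/
def psiSin (z : ℂ) : ℂ := 1 + sin z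

/-- `1 + z - z³ / 3`. -/
def psiNe (z : ℂ) : ℂ := 1 + z - z ^ 3 / 3

/-- The dilation `z ↦ f (r z) / r`. -/
def dilate (f : ℂ → ℂ) (r : ℝ) (z : ℂ) : ℂ := f (r * z) / r

/-- `R` is the `N`-radius of the class `M`: the largest `R ∈ (0, 1]` such that
`z ↦ f (r z) / r` belongs to `N` for all `f ∈ M` and all `0 < r ≤ R`. -/
def IsClassRadius (N M : Set (ℂ → ℂ)) (R : ℝ) : Prop :=
  IsGreatest
    {R : ℝ | 0 < R ∧ R ≤ 1 ∧ ∀ f ∈ M, ∀ r : ℝ, 0 < r → r ≤ R → dilate f r ∈ N} R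

/-- `R` is the `N`-radius of `M`, and it is sharp: a single extremal function in `M` shows that
it cannot be enlarged. -/
def IsSharpRadius (N M : Set (ℂ → ℂ)) (R : ℝ) : Prop :=
  IsClassRadius N M R ∧ ∃ f ∈ M, ∀ r : ℝ, R < r → r ≤ 1 → dilate f r ∉ N

end CarRadius

end

namespace CarRadius

/-! Since `phiCar z = ((1 + z) ^ 2 + 1) / 2`, the equation `phiCar z = w` reads `(1 + z) ^ 2 = 2 * w
- 1`. On the disk `1 + z` has positive real part, so `phiCar` is univalent there with inverse `csqrt
(2 * w - 1) - 1`. Its image is the interior of a cardioid with cusp `1/2`, the value at the critical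
point `-1`; this value is omitted on the open disk.

All nine classes have the same mechanism (`isSharpRadius_of_mapsTo`): `ψ` sends `‖z‖ < R` into the
cardioid and `ψ (-R)` is the cusp. By the Schwarz lemma every dilation with `r ≤ R` is then
subordinate to `phiCar`. For sharpness take `f` with `z f' / f = ψ`, univalent because `ψ` has
positive real part; for `r > R` the quotient of its dilation takes the omitted value `1/2` inside
the disk.

What remains for each class is an inclusion. Near the cusp it comes down to `Re w > 1/2`, and
`mem_cardioidRegion_of_norm_sub_one` shows that this suffices while `‖w - 1‖ ^ 2 ≤ 5 / 4`. The class
`psiRL` uses a disk touching the cusp instead, and the exponential class also needs the quartic test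
`mem_cardioidRegion_of_quartic`. -/

lemma mem_unitDisk {z : ℂ} : z ∈ unitDisk ↔ ‖z‖ < 1 := by
  simp [unitDisk]

lemma sq_add_sq_lt {z : ℂ} {R : ℝ} (hz : ‖z‖ < R) : z.re ^ 2 + z.im ^ 2 < R ^ 2 := by
  have h := Complex.sq_norm z
  rw [Complex.normSq_apply] at h
  nlinarith [norm_nonneg z]

/-! ### The principal square root -/

lemma csqrt_sq (z : ℂ) : csqrt z ^ 2 = z := by
  unfold csqrt
  rw [one_div]
  exact Complex.cpow_nat_inv_pow z two_ne_zero

lemma csqrt_sq_of_re_pos {s : ℂ} (hs : 0 < s.re) : csqrt (s ^ 2) = s := by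
  unfold csqrt
  rw [one_div]
  exact Complex.sq_cpow_two_inv hs

lemma csqrt_one : csqrt 1 = 1 := by
  simp [csqrt]

lemma csqrt_re_pos {z : ℂ} (hz : z ∈ slitPlane) : 0 < (csqrt z).re := by
  have h0 : z ≠ 0 := slitPlane_ne_zero hz
  have harg := Complex.neg_pi_lt_arg z
  have harg' : z.arg < Real.pi :=
    lt_of_le_of_ne (Complex.arg_le_pi z) (mem_slitPlane_iff_arg.1 hz).1
  rw [csqrt, Complex.cpow_def_of_ne_zero h0, Complex.exp_re]
  refine mul_pos (Real.exp_pos _) (Real.cos_pos_of_mem_Ioo ⟨?_, ?_⟩) <;>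
    simp [Complex.mul_im, Complex.log_im] <;> linarith

lemma differentiableAt_csqrt {z : ℂ} (hz : z ∈ slitPlane) : DifferentiableAt ℂ csqrt z :=
  differentiableAt_id.cpow_const hz

lemma mem_slitPlane_of_re_pos {z : ℂ} (hz : 0 < z.re) : z ∈ slitPlane := Or.inl hz

/-- The real part of the principal root dominates the root of any positive lower bound for the
real part. -/
lemma lt_csqrt_re {z : ℂ} {t : ℝ} (hz : t ^ 2 < z.re) : t < (csqrt z).re := by
  have hpos := csqrt_re_pos (mem_slitPlane_of_re_pos ((sq_nonneg t).trans_lt hz))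
  have h := congrArg Complex.re (csqrt_sq z)
  rw [pow_two, Complex.mul_re] at h
  nlinarith [sq_nonneg (csqrt z).im]

/-! ### The cardioid region -/

/-- The image of the unit disk under `phiCar`. -/
def cardioidRegion : Set ℂ :=
  {w | ‖2 * w - 1‖ ^ 2 < 2 * ‖2 * w - 1‖ + 2 * (2 * w - 1).re}

/-- On the closed negative axis `‖2 * w - 1‖ = -(2 * w - 1).re`, so the right side of the defining
inequality vanishes. -/
lemma mem_slitPlane_of_mem_cardioidRegion {w : ℂ} (hw : w ∈ cardioidRegion) :
    2 * w - 1 ∈ slitPlane := by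
  by_contra h
  rw [mem_slitPlane_iff_arg, not_and_or, not_not, not_not] at h
  unfold cardioidRegion at hw
  rw [Set.mem_ofPred_eq] at hw
  rcases h with h | h
  · obtain ⟨h1, h2⟩ := Complex.arg_eq_pi_iff.1 h
    have h3 : ‖2 * w - 1‖ = -(2 * w - 1).re := by
      rw [← abs_of_neg h1, eq_comm, Complex.abs_re_eq_norm]
      exact h2
    rw [h3] at hw
    nlinarith
  · simp [h] at hw

/-- With `s ^ 2 = 2 * w - 1`, the region says `‖s‖ ^ 4 < 2 * ‖s‖ ^ 2 + 2 * (s ^ 2).re = 4 * s.re ^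
2`. As `s.re > 0`, this is `‖s‖ ^ 2 < 2 * s.re`, that is `‖s - 1‖ < 1`. -/
lemma norm_csqrt_sub_one_lt {w : ℂ} (hw : w ∈ cardioidRegion) :
    ‖csqrt (2 * w - 1) - 1‖ < 1 := by
  have hpos := csqrt_re_pos (mem_slitPlane_of_mem_cardioidRegion hw)
  have hsq := csqrt_sq (2 * w - 1)
  unfold cardioidRegion at hw
  rw [Set.mem_ofPred_eq] at hw
  generalize csqrt (2 * w - 1) = s at *
  rw [← hsq, norm_pow, Complex.sq_norm, Complex.normSq_apply, pow_two, pow_two s,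
    Complex.mul_re] at hw
  have h : ‖s - 1‖ ^ 2 < 1 := by
    rw [Complex.sq_norm, Complex.normSq_apply]
    simp only [sub_re, one_re, sub_im, one_im]
    have : s.re * s.re + s.im * s.im < 2 * s.re := by
      apply lt_of_pow_lt_pow_left₀ 2 (by linarith)
      nlinarith
    nlinarith
  nlinarith [norm_nonneg (s - 1)]

lemma phiCar_csqrt (w : ℂ) : phiCar (csqrt (2 * w - 1) - 1) = w := by
  have hsq := csqrt_sq (2 * w - 1)
  unfold phiCar
  linear_combination hsq / 2

lemma phiCar_ne_half {z : ℂ} (hz : z ∈ unitDisk) : phiCar z ≠ 1 / 2 := by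
  intro h
  have h1 : (z + 1) ^ 2 = 0 := by
    unfold phiCar at h
    linear_combination 2 * h
  have h2 : z = -1 := by
    linear_combination pow_eq_zero_iff (two_ne_zero) |>.1 h1
  simp [h2, mem_unitDisk] at hz

lemma norm_sub_one_sq (w : ℂ) : ‖w - 1‖ ^ 2 = (w.re - 1) ^ 2 + w.im ^ 2 := by
  rw [Complex.sq_norm, Complex.normSq_apply]
  simp [pow_two]

/-- Put `D = ‖w - 1‖ ^ 2`. Since `‖2 * w - 1‖ ^ 2 = 4 * D - 1 + 2 * (2 * w.re - 1)`, membership is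
equivalent to `4 * D - 1 < 2 * ‖2 * w - 1‖`; the hypothesis is the square of this. -/
lemma mem_cardioidRegion_of_quartic {w : ℂ}
    (hw : (4 * ‖w - 1‖ ^ 2 - 1) * (4 * ‖w - 1‖ ^ 2 - 5) < 8 * (2 * w.re - 1)) :
    w ∈ cardioidRegion := by
  unfold cardioidRegion
  rw [Set.mem_ofPred_eq]
  have hN : ‖2 * w - 1‖ ^ 2 = 4 * ‖w - 1‖ ^ 2 - 1 + 2 * (2 * w.re - 1) := by
    rw [norm_sub_one_sq, Complex.sq_norm, Complex.normSq_apply]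
    simp
    ring
  have hre : (2 * w - 1).re = 2 * w.re - 1 := by simp
  rw [hre]
  have : 4 * ‖w - 1‖ ^ 2 - 1 < 2 * ‖2 * w - 1‖ := by
    apply lt_of_pow_lt_pow_left₀ 2 (by positivity)
    nlinarith
  linarith

/-- For `1/4 ≤ ‖w - 1‖ ^ 2 ≤ 5/4` the quartic is nonpositive; below `1/4` the unsquared inequality
is immediate. -/
lemma mem_cardioidRegion_of_norm_sub_one {w : ℂ} (h : 1 / 2 < w.re)
    (hw : ‖w - 1‖ ^ 2 ≤ 5 / 4) : w ∈ cardioidRegion := by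
  by_cases hD : 1 / 4 ≤ ‖w - 1‖ ^ 2
  · exact mem_cardioidRegion_of_quartic (by nlinarith)
  · unfold cardioidRegion
    rw [Set.mem_ofPred_eq]
    have hN : ‖2 * w - 1‖ ^ 2 = 4 * ‖w - 1‖ ^ 2 - 1 + 2 * (2 * w.re - 1) := by
      rw [norm_sub_one_sq, Complex.sq_norm, Complex.normSq_apply]
      simp
      ring
    have hre : (2 * w - 1).re = 2 * w.re - 1 := by simp
    rw [hre]
    linarith [norm_nonneg (2 * w - 1)]

lemma mem_cardioidRegion_of_disk {w : ℂ} (hw : ‖w - 3 / 2‖ < 1) : w ∈ cardioidRegion := by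
  unfold cardioidRegion
  rw [Set.mem_ofPred_eq]
  have h := sq_add_sq_lt hw
  have h1 := Complex.re_le_norm (2 * w - 1)
  have hN : ‖2 * w - 1‖ ^ 2 < 4 * (2 * w - 1).re := by
    rw [Complex.sq_norm, Complex.normSq_apply]
    norm_num at h ⊢
    nlinarith
  linarith

/-! ### Starlike functions with prescribed quotient -/

/-- A holomorphic function whose derivative has positive real part on a convex set is injective
there. -/
lemma injOn_of_re_deriv_pos {F F' : ℂ → ℂ} {U : Set ℂ} (hU : Convex ℝ U)
    (hF : ∀ z ∈ U, HasDerivAt F (F' z) z) (hpos : ∀ z ∈ U, 0 < (F' z).re) : Set.InjOn F U := by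
  intro a ha b hb hab
  by_contra hne
  have hne' : b - a ≠ 0 := sub_ne_zero.2 (Ne.symm hne)
  have hmem : ∀ t ∈ Set.Icc (0 : ℝ) 1, a + t * (b - a) ∈ U := by
    intro t ht
    have := hU.add_smul_sub_mem ha hb ht
    simpa using this
  have hd : ∀ t ∈ Set.Icc (0 : ℝ) 1,
      HasDerivAt (fun t : ℝ => (F (a + t * (b - a)) / (b - a)).re)
        (F' (a + t * (b - a))).re t := by
    intro t ht
    have h1 : HasDerivAt (fun s : ℂ => a + s * (b - a)) (b - a) (t : ℂ) := by
      simpa using ((hasDerivAt_id (t : ℂ)).mul_const (b - a)).const_add a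
    have h2 := ((hF _ (hmem t ht)).comp (t : ℂ) h1).div_const (b - a)
    rw [mul_div_cancel_right₀ _ hne'] at h2
    exact h2.real_of_complex
  have hmono : StrictMonoOn (fun t : ℝ => (F (a + t * (b - a)) / (b - a)).re)
      (Set.Icc 0 1) := by
    apply strictMonoOn_of_deriv_pos (convex_Icc 0 1)
    · exact fun t ht => (hd t ht).continuousAt.continuousWithinAt
    · intro t ht
      have ht' := interior_subset ht
      rw [(hd t ht').deriv]
      exact hpos _ (hmem t ht')
  have := hmono (by simp) (by simp) (zero_lt_one' ℝ)
  simp [hab] at this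

/-- For `ψ` holomorphic on the disk with `ψ 0 = 1` and positive real part there is a normalized
univalent `f` with `z f' / f = ψ`. -/
theorem exists_univalent_starQuotient_eq {ψ : ℂ → ℂ} (hψ : DifferentiableOn ℂ ψ unitDisk)
    (h0 : ψ 0 = 1) (hre : ∀ z ∈ unitDisk, 0 < (ψ z).re) :
    ∃ f, IsNormalizedUnivalent f ∧ ∀ z ∈ unitDisk, starQuotient f z = ψ z := by
  have hnhds : unitDisk ∈ nhds (0 : ℂ) := Metric.ball_mem_nhds 0 one_pos
  have hds : DifferentiableOn ℂ (dslope ψ 0) unitDisk :=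
    (Complex.differentiableOn_dslope hnhds).2 hψ
  -- `h` is a primitive of `(ψ - 1) / z`, so `f = z * exp h` has `f' = exp h * ψ`.
  obtain ⟨h, hh⟩ := DifferentiableOn.isExactOn_ball hds
  wlog hh0 : h 0 = 0 generalizing h
  · exact this (fun z => h z - h 0) (fun z hz => (hh z hz).sub_const _) (by simp)
  have hmul : ∀ z : ℂ, z * dslope ψ 0 z = ψ z - 1 := by
    intro z
    have := sub_smul_dslope ψ 0 z
    simpa [h0] using this
  set f : ℂ → ℂ := fun z => z * exp (h z) with hf
  have hfd : ∀ z ∈ unitDisk, HasDerivAt f (exp (h z) * ψ z) z := by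
    intro z hz
    have := (hasDerivAt_id z).mul (hh z hz).cexp
    refine this.congr_deriv ?_
    simp only [id]
    linear_combination exp (h z) * hmul z
  have hzero : (0 : ℂ) ∈ unitDisk := by simp [mem_unitDisk]
  refine ⟨f, ⟨fun z hz => (hfd z hz).differentiableAt.differentiableWithinAt, by simp [hf], ?_, ?_⟩,
    ?_⟩
  · rw [(hfd 0 hzero).deriv, hh0, h0]
    simp
  · have hexp : ∀ ζ : ℂ, ζ.re < 0 → exp ζ ∈ unitDisk := by
      intro ζ hζ
      rw [mem_unitDisk, Complex.norm_exp]
      simpa using hζ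
    -- This is `log f` in the coordinate `ζ = log z`: its derivative `ψ (exp ζ)` has positive real
    -- part on the convex left half-plane. Equality `f a = f b` lifts to the half-plane after a
    -- shift by a multiple of `2πi`.
    have hF : Set.InjOn (fun ζ => ζ + h (exp ζ)) {ζ : ℂ | ζ.re < 0} := by
      apply injOn_of_re_deriv_pos (F' := fun ζ => ψ (exp ζ)) (convex_halfSpace_re_lt 0)
      · intro ζ hζ
        have h1 := (hh _ (hexp ζ hζ)).comp ζ (Complex.hasDerivAt_exp ζ)
        refine ((hasDerivAt_id ζ).add h1).congr_deriv ?_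
        linear_combination hmul (exp ζ)
      · exact fun ζ hζ => hre _ (hexp ζ hζ)
    intro a ha b hb hab
    have hlog : ∀ z ∈ unitDisk, z ≠ 0 → (log z).re < 0 := by
      intro z hz hz0
      rw [Complex.log_re]
      exact Real.log_neg (norm_pos_iff.2 hz0) (mem_unitDisk.1 hz)
    by_cases ha0 : a = 0
    · subst ha0
      simp [hf] at hab
      exact hab.symm
    by_cases hb0 : b = 0
    · subst hb0
      simp [hf] at hab
      exact hab
    have hE : exp (log a + h a) = exp (log b + h b) := by
      rw [Complex.exp_add, Complex.exp_add, Complex.exp_log ha0, Complex.exp_log hb0]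
      exact hab
    obtain ⟨n, hn⟩ := Complex.exp_eq_exp_iff_exists_int.1 hE
    have hper : exp (log b + n * (2 * Real.pi * I)) = b := by
      rw [Complex.exp_periodic.int_mul n, Complex.exp_log hb0]
    have := hF (hlog a ha ha0) (x₂ := log b + n * (2 * Real.pi * I))
      (by simpa using hlog b hb hb0)
      (by
        simp only [hper, Complex.exp_log ha0]
        linear_combination hn)
    rw [← Complex.exp_log ha0, this, hper]
  · intro z hz
    unfold starQuotient
    split_ifs with hz0
    · rw [hz0, h0]
    · rw [(hfd z hz).deriv, hf]
      field_simp

/-! ### Dilations -/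

lemma mul_mem_unitDisk {r : ℝ} (hr : 0 < r) (hr1 : r ≤ 1) {z : ℂ} (hz : z ∈ unitDisk) :
    (r : ℂ) * z ∈ unitDisk ∧ ‖(r : ℂ) * z‖ < r := by
  rw [mem_unitDisk] at hz ⊢
  rw [norm_mul, Complex.norm_real, Real.norm_of_nonneg hr.le]
  constructor <;> nlinarith [norm_nonneg z]

lemma deriv_dilate (f : ℂ → ℂ) {r : ℝ} (hr : 0 < r) (z : ℂ) :
    deriv (dilate f r) z = deriv f (r * z) := by
  have hr0 : (r : ℂ) ≠ 0 := by exact_mod_cast hr.ne'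
  unfold dilate
  rw [deriv_div_const, deriv_comp_mul_left, smul_eq_mul]
  field_simp

lemma starQuotient_dilate (f : ℂ → ℂ) {r : ℝ} (hr : 0 < r) (z : ℂ) :
    starQuotient (dilate f r) z = starQuotient f (r * z) := by
  have hr0 : (r : ℂ) ≠ 0 := by exact_mod_cast hr.ne'
  unfold starQuotient
  rw [deriv_dilate f hr]
  by_cases hz : z = 0
  · simp [hz]
  · simp only [hz, mul_eq_zero, hr0, or_self, if_false, dilate]
    rw [div_div_eq_mul_div]
    ring

lemma IsNormalizedUnivalent.dilate {f : ℂ → ℂ} (hf : IsNormalizedUnivalent f) {r : ℝ}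
    (hr : 0 < r) (hr1 : r ≤ 1) : IsNormalizedUnivalent (dilate f r) where
  differentiableOn := by
    have : DifferentiableOn ℂ (fun z : ℂ => f (r * z)) unitDisk :=
      hf.differentiableOn.comp (by fun_prop) fun z hz => (mul_mem_unitDisk hr hr1 hz).1
    exact this.div_const _
  map_zero := by simp [CarRadius.dilate, hf.map_zero]
  deriv_zero := by rw [deriv_dilate f hr, mul_zero, hf.deriv_zero]
  injOn := by
    have hr0 : (r : ℂ) ≠ 0 := by exact_mod_cast hr.ne'
    intro a ha b hb hab
    have h1 : f (r * a) = f (r * b) := by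
      simpa [CarRadius.dilate, div_left_inj' hr0] using hab
    exact mul_left_cancel₀ hr0
      (hf.injOn (mul_mem_unitDisk hr hr1 ha).1 (mul_mem_unitDisk hr hr1 hb).1 h1)

/-- The Schwarz lemma keeps `ω (r * z)` in the disk of radius `r`, so the inverse of `phiCar` can be
applied to `ψ (ω (r * z))`; the result is the required Schwarz function. -/
lemma dilate_mem_starCar {ψ f : ℂ → ℂ} (hψ : DifferentiableOn ℂ ψ unitDisk) (h0 : ψ 0 = 1)
    {r : ℝ} (hr : 0 < r) (hr1 : r ≤ 1) (hin : ∀ z : ℂ, ‖z‖ < r → ψ z ∈ cardioidRegion)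
    (hf : f ∈ starClass ψ) : dilate f r ∈ starCar := by
  obtain ⟨hfu, ω, hωd, hωm, hω0, hω⟩ := hf
  refine ⟨hfu.dilate hr hr1, fun z => csqrt (2 * ψ (ω (r * z)) - 1) - 1, ?_, ?_, ?_, ?_⟩
  all_goals
    have hmem : ∀ z ∈ unitDisk, ψ (ω (r * z)) ∈ cardioidRegion := by
      intro z hz
      obtain ⟨h1, h2⟩ := mul_mem_unitDisk hr hr1 hz
      have := Complex.norm_le_norm_of_mapsTo_ball hωd
        (hωm.mono_right Metric.ball_subset_closedBall) hω0 (mem_unitDisk.1 h1)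
      exact hin _ (this.trans_lt h2)
  · have h1 : DifferentiableOn ℂ (fun z : ℂ => ω (r * z)) unitDisk :=
      hωd.comp (by fun_prop) fun z hz => (mul_mem_unitDisk hr hr1 hz).1
    have h2 : DifferentiableOn ℂ (fun z : ℂ => ψ (ω (r * z))) unitDisk :=
      hψ.comp h1 fun z hz => hωm (mul_mem_unitDisk hr hr1 hz).1
    intro z hz
    have h3 := ((h2.const_mul 2).sub_const 1) z hz
    exact ((differentiableAt_csqrt
      (mem_slitPlane_of_mem_cardioidRegion (hmem z hz))).comp_differentiableWithinAt z
        h3).sub_const 1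
  · exact fun z hz => mem_unitDisk.2 (norm_csqrt_sub_one_lt (hmem z hz))
  · norm_num [hω0, h0, csqrt_one]
  · intro z hz
    rw [phiCar_csqrt, starQuotient_dilate f hr, hω _ (mul_mem_unitDisk hr hr1 hz).1]

/-- If `ψ` maps the disk of radius `R` into the cardioid region and takes the cuspidal value `1/2`
on its boundary, then `R` is the sharp `𝒮*_car`-radius of `𝒮*(ψ)`. -/
theorem isSharpRadius_of_mapsTo {ψ : ℂ → ℂ} (hψ : DifferentiableOn ℂ ψ unitDisk) (h0 : ψ 0 = 1)
    (hre : ∀ z ∈ unitDisk, 0 < (ψ z).re) {R : ℝ} (hR : 0 < R) (hR1 : R ≤ 1)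
    (hin : ∀ z : ℂ, ‖z‖ < R → ψ z ∈ cardioidRegion) (hbd : ψ (-R) = 1 / 2) :
    IsSharpRadius starCar (starClass ψ) R := by
  obtain ⟨f, hfu, hf⟩ := exists_univalent_starQuotient_eq hψ h0 hre
  have hfM : f ∈ starClass ψ := ⟨hfu, id, differentiableOn_id, Set.mapsTo_id _, rfl, hf⟩
  have hsharp : ∀ r : ℝ, R < r → r ≤ 1 → dilate f r ∉ starCar := by
    rintro r hRr hr1 ⟨-, ω, -, hωm, -, hω⟩
    have hr : 0 < r := hR.trans hRr
    have hr0 : (r : ℂ) ≠ 0 := by exact_mod_cast hr.ne'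
    -- The dilation carries this point to `-R`, where `ψ` takes the cuspidal value.
    have hz : (-R / r : ℂ) ∈ unitDisk := by
      rw [mem_unitDisk, norm_div, norm_neg, Complex.norm_real, Complex.norm_real,
        Real.norm_of_nonneg hR.le, Real.norm_of_nonneg hr.le, div_lt_one hr]
      exact hRr
    have h1 := hω _ hz
    rw [starQuotient_dilate f hr, hf _ (mul_mem_unitDisk hr hr1 hz).1,
      mul_div_cancel₀ _ hr0, hbd] at h1
    exact phiCar_ne_half (hωm hz) h1.symm
  refine ⟨⟨⟨hR, hR1, ?_⟩, ?_⟩, f, hfM, hsharp⟩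
  · exact fun g hg r hr hrR => dilate_mem_starCar hψ h0 hr (hrR.trans hR1)
      (fun z hz => hin z (hz.trans_le hrR)) hg
  · rintro R' ⟨hR', hR'1, hall⟩
    by_contra hlt
    exact hsharp R' (not_le.1 hlt) hR'1 (hall f hfM R' hR' le_rfl)

/-! ### Classes built from the square root -/

lemma one_add_re_pos {z : ℂ} (hz : ‖z‖ < 1) : 0 < (1 + z).re := by
  have := Complex.abs_re_le_norm z
  have := neg_abs_le z.re
  rw [add_re, one_re]
  linarith

lemma lt_re_csqrt_one_add {z : ℂ} {t : ℝ} (hz : ‖z‖ < 1 - t ^ 2) : t < (csqrt (1 + z)).re := by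
  apply lt_csqrt_re
  have := Complex.abs_re_le_norm z
  have := neg_abs_le z.re
  rw [add_re, one_re]
  linarith

/-- The product of `csqrt (1 + z) - 1` and `csqrt (1 + z) + 1` is `z`, and the second factor has
norm at least `1`. -/
lemma norm_csqrt_one_add_sub_one_le {z : ℂ} (hz : ‖z‖ < 1) : ‖csqrt (1 + z) - 1‖ ≤ 1 := by
  have h1 := csqrt_re_pos (mem_slitPlane_of_re_pos (one_add_re_pos hz))
  have h2 : 1 ≤ ‖csqrt (1 + z) + 1‖ := by
    have := Complex.re_le_norm (csqrt (1 + z) + 1)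
    rw [add_re, one_re] at this
    linarith
  have h3 : ‖csqrt (1 + z) - 1‖ * ‖csqrt (1 + z) + 1‖ = ‖z‖ := by
    rw [← norm_mul]
    congr 1
    linear_combination csqrt_sq (1 + z)
  nlinarith [norm_nonneg (csqrt (1 + z) - 1)]

lemma norm_ofReal_mul_lt {c : ℝ} (hc : 0 < c) {z : ℂ} {R : ℝ} (hz : ‖z‖ < R) :
    ‖(c : ℂ) * z‖ < c * R := by
  rw [norm_mul, Complex.norm_real, Real.norm_of_nonneg hc.le]
  exact mul_lt_mul_of_pos_left hz hc

theorem isSharpRadius_psiCassini {c : ℝ} (hc : 3 / 4 < c) (hc1 : c ≤ 1) :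
    IsSharpRadius starCar (starClass (psiCassini c)) (3 / (4 * c)) := by
  have hc0 : 0 < c := by linarith
  have hcz : ∀ z ∈ unitDisk, ‖(c : ℂ) * z‖ < 1 := fun z hz =>
    (norm_ofReal_mul_lt hc0 (mem_unitDisk.1 hz)).trans_le (by linarith)
  apply isSharpRadius_of_mapsTo
  · intro z hz
    refine DifferentiableAt.differentiableWithinAt ?_
    exact DifferentiableAt.comp z (g := csqrt)
      (differentiableAt_csqrt (mem_slitPlane_of_re_pos (one_add_re_pos (hcz z hz))))
      (by fun_prop)
  · simp [psiCassini, csqrt_one]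
  · exact fun z hz => csqrt_re_pos (mem_slitPlane_of_re_pos (one_add_re_pos (hcz z hz)))
  · positivity
  · rw [div_le_one (by positivity)]
    linarith
  · intro z hz
    have h := norm_ofReal_mul_lt hc0 hz
    have hR : c * (3 / (4 * c)) = 3 / 4 := by field_simp
    rw [hR] at h
    refine mem_cardioidRegion_of_norm_sub_one (lt_re_csqrt_one_add (h.trans_le (by norm_num))) ?_
    have := norm_csqrt_one_add_sub_one_le (h.trans (by norm_num))
    unfold psiCassini
    nlinarith [norm_nonneg (csqrt (1 + c * z) - 1)]
  · have hc' : (c : ℂ) ≠ 0 := by exact_mod_cast hc0.ne'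
    have h : 1 + (c : ℂ) * -((3 / (4 * c) : ℝ) : ℂ) = (1 / 2 : ℂ) ^ 2 := by
      push_cast
      field_simp
      norm_num
    rw [psiCassini, h, csqrt_sq_of_re_pos (by norm_num)]

theorem isSharpRadius_psiL {α : ℝ} (hα : 0 ≤ α) (hα1 : α < 1 / 2) :
    IsSharpRadius starCar (starClass (psiL α)) ((3 - 4 * α) / (4 * (1 - α) ^ 2)) := by
  have hk : 0 < 1 - α := by linarith
  -- `t` solves `α + (1 - α) * t = 1/2`: it is the root value at the cusp, whence `R = 1 - t ^ 2`.
  obtain ⟨t, ht⟩ : ∃ t, t = (1 - 2 * α) / (2 * (1 - α)) := ⟨_, rfl⟩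
  have htk : 2 * (1 - α) * t = 1 - 2 * α := by rw [ht]; field_simp
  have ht0 : 0 < t := by rw [ht]; apply div_pos <;> linarith
  have hR : (3 - 4 * α) / (4 * (1 - α) ^ 2) = 1 - t ^ 2 := by
    rw [ht]
    field_simp
    ring
  have ht1 : t < 1 := by nlinarith
  have hre : ∀ s : ℂ, ((α : ℂ) + (1 - α) * s).re = α + (1 - α) * s.re := by
    intro s
    simp [mul_re]
  rw [hR]
  apply isSharpRadius_of_mapsTo
  · intro z hz
    refine DifferentiableAt.differentiableWithinAt ?_
    have : DifferentiableAt ℂ (fun z => csqrt (1 + z)) z :=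
      DifferentiableAt.comp z (g := csqrt) (differentiableAt_csqrt
        (mem_slitPlane_of_re_pos (one_add_re_pos (mem_unitDisk.1 hz)))) (by fun_prop)
    exact (this.const_mul _).const_add _
  · simp [psiL, csqrt_one]
  · intro z hz
    have := csqrt_re_pos (mem_slitPlane_of_re_pos (one_add_re_pos (mem_unitDisk.1 hz)))
    rw [psiL, hre]
    positivity
  · nlinarith
  · nlinarith
  · intro z hz
    have h1 := lt_re_csqrt_one_add hz
    have h2 := norm_csqrt_one_add_sub_one_le (z := z) (hz.trans_le (by nlinarith))
    apply mem_cardioidRegion_of_norm_sub_one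
    · rw [psiL, hre]
      nlinarith
    · have h3 : psiL α z - 1 = ((1 - α : ℝ) : ℂ) * (csqrt (1 + z) - 1) := by
        unfold psiL
        push_cast
        ring
      rw [h3, norm_mul, Complex.norm_real, Real.norm_of_nonneg hk.le]
      have h4 : (1 - α) * ‖csqrt (1 + z) - 1‖ ≤ 1 := by
        nlinarith [norm_nonneg (csqrt (1 + z) - 1)]
      have h5 : 0 ≤ (1 - α) * ‖csqrt (1 + z) - 1‖ := by positivity
      nlinarith
  · have h : (1 : ℂ) + -((1 - t ^ 2 : ℝ) : ℂ) = (t : ℂ) ^ 2 := by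
      push_cast
      ring
    have htk' : 2 * (1 - (α : ℂ)) * t = 1 - 2 * α := by exact_mod_cast htk
    rw [psiL, h, csqrt_sq_of_re_pos (by simpa using ht0)]
    linear_combination htk' / 2

theorem isSharpRadius_psiRL :
    IsSharpRadius starCar (starClass psiRL) ((39 + 17 * √2) / 82) := by
  have h2 : √2 ^ 2 = 2 := Real.sq_sqrt (by norm_num)
  have hlo : 1.41 < √2 := Real.lt_sqrt_of_sq_lt (by norm_num)
  have hhi : √2 < 1.415 := by
    rw [Real.sqrt_lt' (by norm_num)]
    norm_num
  obtain ⟨c, hc⟩ : ∃ c, c = √2 - 1 := ⟨_, rfl⟩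
  have hc0 : 0 < c := by linarith
  have hψ : ∀ z, psiRL z = (√2 : ℝ) - c * csqrt ((1 - z) / (1 + (2 * c : ℝ) * z)) := by
    intro z
    unfold psiRL
    rw [hc]
    push_cast
    rfl
  have hden : ∀ (z : ℂ) (R : ℝ), ‖z‖ < R → 1 - 2 * c * R < ‖1 + (2 * c : ℝ) * z‖ := by
    intro z R hz
    have h := norm_ofReal_mul_lt (c := 2 * c) (by linarith) hz
    have := norm_sub_norm_le (1 : ℂ) (-((2 * c : ℝ) * z))
    rw [sub_neg_eq_add, norm_neg, norm_one] at this
    linarith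
  have hden0 : ∀ z ∈ unitDisk, 1 + (2 * c : ℝ) * z ≠ 0 := by
    intro z hz h
    have := hden z 1 (mem_unitDisk.1 hz)
    rw [h, norm_zero] at this
    linarith
  have hnum : ∀ (z : ℂ) (R : ℝ), ‖z‖ < R → ‖1 - z‖ < 1 + R := by
    intro z R hz
    have := norm_sub_le (1 : ℂ) z
    rw [norm_one] at this
    linarith
  -- The modulus of the root is largest at `z = -R`, where its value is `s`.
  have hroot : ∀ (z : ℂ) (R s : ℝ), ‖z‖ < R → 0 ≤ s → 0 < 1 - 2 * c * R →
      1 + R = s ^ 2 * (1 - 2 * c * R) →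
      ‖csqrt ((1 - z) / (1 + (2 * c : ℝ) * z))‖ < s := by
    intro z R s hz hs hpos hR
    apply lt_of_pow_lt_pow_left₀ 2 hs
    have hd := hden z R hz
    rw [← norm_pow, csqrt_sq, norm_div, div_lt_iff₀ (hpos.trans hd)]
    calc ‖1 - z‖ < s ^ 2 * (1 - 2 * c * R) := by
          rw [← hR]
          exact hnum z R hz
      _ ≤ _ := by gcongr
  have hslit : ∀ z ∈ unitDisk, (1 - z) / (1 + (2 * c : ℝ) * z) ∈ slitPlane := by
    intro z hz
    apply mem_slitPlane_of_re_pos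
    have hn : 0 < normSq (1 + (2 * c : ℝ) * z) := normSq_pos.2 (hden0 z hz)
    have hsq := sq_add_sq_lt (mem_unitDisk.1 hz)
    have hx : z.re < 1 := (Complex.re_le_norm z).trans_lt (mem_unitDisk.1 hz)
    rw [Complex.div_re, ← add_div]
    apply div_pos _ hn
    simp only [sub_re, one_re, add_re, mul_re, ofReal_re, ofReal_im, sub_im, one_im, add_im,
      mul_im, zero_mul, sub_zero, zero_sub, zero_add, add_zero]
    nlinarith
  apply isSharpRadius_of_mapsTo
  · intro z hz
    refine DifferentiableAt.differentiableWithinAt ?_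
    have h1 : DifferentiableAt ℂ (fun z : ℂ => (1 - z) / (1 + (2 * c : ℝ) * z)) z :=
      DifferentiableAt.div (by fun_prop) (by fun_prop) (hden0 z hz)
    have h2 : DifferentiableAt ℂ (fun z : ℂ => csqrt ((1 - z) / (1 + (2 * c : ℝ) * z))) z :=
      DifferentiableAt.comp z (g := csqrt) (differentiableAt_csqrt (hslit z hz)) h1
    rw [funext hψ]
    exact (h2.const_mul _).const_sub _
  · rw [hψ, hc]
    simp [csqrt_one]
  · intro z hz
    -- Here `c * (2 + √2) = √2`, which gives `0 < (psiRL z).re`.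
    have h := hroot z 1 (2 + √2) (mem_unitDisk.1 hz) (by positivity) (by linarith)
      (by rw [hc]; ring_nf; rw [show √2 ^ 3 = √2 * √2 ^ 2 by ring, h2]; ring)
    have h' := Complex.re_le_norm (csqrt ((1 - z) / (1 + (2 * c : ℝ) * z)))
    rw [hψ, sub_re, ofReal_re, re_ofReal_mul]
    nlinarith
  · positivity
  · linarith
  · intro z hz
    obtain ⟨R, hR⟩ : ∃ R, R = (39 + 17 * √2) / 82 := ⟨_, rfl⟩
    rw [← hR] at hz
    -- Here `c * (3 + √2) / 2 = √2 - 1/2`, so the distance to `3/2` is less than `(3/2 - √2) + (√2 -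
    -- 1/2) = 1`.
    have h := hroot z R ((3 + √2) / 2) hz (by positivity) (by rw [hR]; nlinarith)
      (by
        rw [hR, hc]
        ring_nf
        rw [show √2 ^ 3 = √2 * √2 ^ 2 by ring, show √2 ^ 4 = (√2 ^ 2) ^ 2 by ring, h2]
        ring)
    apply mem_cardioidRegion_of_disk
    rw [hψ]
    have h3 : ((√2 : ℝ) : ℂ) - c * csqrt ((1 - z) / (1 + (2 * c : ℝ) * z)) - 3 / 2 =
        -(((3 / 2 - √2 : ℝ) : ℂ) + c * csqrt ((1 - z) / (1 + (2 * c : ℝ) * z))) := by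
      push_cast
      ring
    rw [h3, norm_neg]
    refine (norm_add_le _ _).trans_lt ?_
    rw [norm_mul, Complex.norm_real, Complex.norm_real, Real.norm_of_nonneg (by linarith),
      Real.norm_of_nonneg hc0.le]
    nlinarith
  · have h : (1 - -(((39 + 17 * √2) / 82 : ℝ) : ℂ)) /
        (1 + (2 * c : ℝ) * -(((39 + 17 * √2) / 82 : ℝ) : ℂ)) =
        (((3 + √2) / 2 : ℝ) : ℂ) ^ 2 := by
      norm_cast
      rw [div_eq_iff (by nlinarith), hc]
      ring_nf
      rw [show √2 ^ 3 = √2 * √2 ^ 2 by ring, show √2 ^ 4 = (√2 ^ 2) ^ 2 by ring, h2]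
      ring
    rw [hψ, h, csqrt_sq_of_re_pos (by rw [ofReal_re]; positivity), hc]
    have h2' : ((√2 : ℝ) : ℂ) ^ 2 = 2 := by exact_mod_cast h2
    push_cast
    linear_combination -h2' / 2

theorem isSharpRadius_psiCrescent :
    IsSharpRadius starCar (starClass psiCrescent) (3 / 4) := by
  have hq : ∀ z ∈ unitDisk, 1 + z ^ 2 ∈ slitPlane := by
    intro z hz
    apply mem_slitPlane_of_re_pos
    apply one_add_re_pos
    rw [norm_pow]
    exact pow_lt_one₀ (norm_nonneg _) (mem_unitDisk.1 hz) two_ne_zero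
  have hpos : ∀ z ∈ unitDisk, 0 < (psiCrescent z).re := by
    intro z hz
    have h1 := csqrt_re_pos (hq z hz)
    have h2 := congrArg Complex.re (csqrt_sq (1 + z ^ 2))
    have h3 := sq_add_sq_lt (mem_unitDisk.1 hz)
    rw [pow_two, pow_two z, mul_re, add_re, one_re, mul_re, ← pow_two z] at h2
    have h4 : |z.re| < (csqrt (1 + z ^ 2)).re := by
      apply abs_lt_of_sq_lt_sq _ h1.le
      nlinarith [sq_nonneg z.re, sq_nonneg (csqrt (1 + z ^ 2)).im]
    rw [psiCrescent, add_re]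
    linarith [neg_abs_le z.re]
  apply isSharpRadius_of_mapsTo
  · intro z hz
    refine DifferentiableAt.differentiableWithinAt ?_
    have : DifferentiableAt ℂ (fun z : ℂ => csqrt (1 + z ^ 2)) z :=
      DifferentiableAt.comp z (g := csqrt) (differentiableAt_csqrt (hq z hz)) (by fun_prop)
    exact differentiableAt_id.add this
  · simp [psiCrescent, csqrt_one]
  · exact hpos
  · norm_num
  · norm_num
  · intro z hz
    have hw := hpos z (mem_unitDisk.2 (by linarith))
    -- Equivalently `w - 1 / w = 2 * z`, which eliminates the square root.
    have hwz : psiCrescent z ^ 2 - 1 = 2 * z * psiCrescent z := by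
      unfold psiCrescent
      linear_combination csqrt_sq (1 + z ^ 2)
    generalize psiCrescent z = w at *
    have hw0 : w ≠ 0 := fun h => by simp [h] at hw
    have hn : ‖w ^ 2 - 1‖ ^ 2 < 9 / 4 * ‖w‖ ^ 2 := by
      rw [hwz, norm_mul, norm_mul, mul_pow]
      have h0 : 0 < ‖w‖ ^ 2 := by positivity
      have h1 : ‖(2 : ℂ)‖ = 2 := by norm_num
      rw [h1]
      have h2 : (2 * ‖z‖) ^ 2 < 9 / 4 := by nlinarith [norm_nonneg z]
      exact mul_lt_mul_of_pos_right h2 h0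
    have key : (w.re ^ 2 + w.im ^ 2) ^ 2 - (w.re ^ 2 + w.im ^ 2) / 4 + 1 < 4 * w.re ^ 2 := by
      rw [Complex.sq_norm, Complex.sq_norm, normSq_apply, normSq_apply] at hn
      simp [pow_two] at hn
      nlinarith
    obtain ⟨m, hm⟩ : ∃ m, m = w.re ^ 2 + w.im ^ 2 := ⟨_, rfl⟩
    have hxm : w.re ^ 2 ≤ m := by nlinarith [sq_nonneg w.im]
    rw [← hm] at key
    -- Inserting `w.re ^ 2 ≤ m` into `key` gives `(m - 1/4) * (m - 4) < 0`.
    have hm1 : 1 / 4 < m := by nlinarith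
    have hx : 1 / 2 < w.re := by nlinarith
    refine mem_cardioidRegion_of_norm_sub_one hx ?_
    rw [norm_sub_one_sq]
    have : m - 1 / 4 ≤ 2 * w.re := by
      apply le_of_sq_le_sq _ (by linarith)
      nlinarith
    nlinarith
  · have h : 1 + (-((3 / 4 : ℝ) : ℂ)) ^ 2 = (5 / 4 : ℂ) ^ 2 := by
      push_cast
      norm_num
    rw [psiCrescent, h, csqrt_sq_of_re_pos (by norm_num)]
    push_cast
    norm_num

/-! ### Polynomial classes -/

theorem isSharpRadius_psiC : IsSharpRadius starCar (starClass psiC) (1 / 2) := by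
  have hre : ∀ z : ℂ, (psiC z).re = 1 + 4 / 3 * z.re + 2 / 3 * (z.re ^ 2 - z.im ^ 2) := by
    intro z
    have : psiC z = 1 + (4 / 3 : ℝ) * z + (2 / 3 : ℝ) * z ^ 2 := by
      unfold psiC
      push_cast
      ring
    rw [this]
    rw [add_re, add_re, one_re, re_ofReal_mul, re_ofReal_mul, pow_two, mul_re]
    ring
  apply isSharpRadius_of_mapsTo
  · unfold psiC
    fun_prop
  · simp [psiC]
  · intro z hz
    have := sq_add_sq_lt (mem_unitDisk.1 hz)
    rw [hre]
    nlinarith [sq_nonneg (2 * z.re + 1)]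
  · norm_num
  · norm_num
  · intro z hz
    apply mem_cardioidRegion_of_norm_sub_one
    · have := sq_add_sq_lt hz
      rw [hre]
      nlinarith [sq_nonneg (2 * z.re + 1)]
    · have h : psiC z - 1 = (4 / 3 : ℝ) * z + (2 / 3 : ℝ) * z ^ 2 := by
        unfold psiC
        push_cast
        ring
      have h1 : ‖psiC z - 1‖ ≤ 1 := by
        rw [h]
        refine (norm_add_le _ _).trans ?_
        rw [norm_mul, norm_mul, norm_pow, Complex.norm_real, Complex.norm_real]
        norm_num
        nlinarith [norm_nonneg z]
      nlinarith [norm_nonneg (psiC z - 1)]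
  · norm_num [psiC]

theorem isSharpRadius_psiLim : IsSharpRadius starCar (starClass psiLim) (√2 - 1) := by
  have h2 : √2 ^ 2 = 2 := Real.sq_sqrt (by norm_num)
  have hlo : 1.41 < √2 := Real.lt_sqrt_of_sq_lt (by norm_num)
  have hhi : √2 < 1.415 := by
    rw [Real.sqrt_lt' (by norm_num)]
    norm_num
  have hre : ∀ z : ℂ, (psiLim z).re = 1 + √2 * z.re + 1 / 2 * (z.re ^ 2 - z.im ^ 2) := by
    intro z
    have : psiLim z = 1 + (√2 : ℝ) * z + (1 / 2 : ℝ) * z ^ 2 := by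
      unfold psiLim
      push_cast
      ring
    rw [this]
    rw [add_re, add_re, one_re, re_ofReal_mul, re_ofReal_mul, pow_two, mul_re]
    ring
  apply isSharpRadius_of_mapsTo
  · unfold psiLim
    fun_prop
  · simp [psiLim]
  · intro z hz
    have := sq_add_sq_lt (mem_unitDisk.1 hz)
    rw [hre]
    nlinarith [sq_nonneg (2 * z.re + √2)]
  · linarith
  · linarith
  · intro z hz
    apply mem_cardioidRegion_of_norm_sub_one
    · have h3 := sq_add_sq_lt hz
      have h4 := neg_abs_le z.re
      have h5 := Complex.abs_re_le_norm z
      -- After `z.im ^ 2` is bounded by `R ^ 2 - z.re ^ 2`, the lower bound for the real part is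
      -- `1/2` plus this product.
      have h6 : 0 ≤ (z.re + (√2 - 1)) * (z.re + 1) := by
        apply mul_nonneg <;> linarith
      rw [hre]
      nlinarith
    · have h : psiLim z - 1 = (√2 : ℝ) * z + (1 / 2 : ℝ) * z ^ 2 := by
        unfold psiLim
        push_cast
        ring
      have h1 : ‖psiLim z - 1‖ ≤ 1 := by
        rw [h]
        refine (norm_add_le _ _).trans ?_
        rw [norm_mul, norm_mul, norm_pow, Complex.norm_real, Complex.norm_real,
          Real.norm_of_nonneg (by positivity), Real.norm_of_nonneg (by positivity)]
        nlinarith [norm_nonneg z]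
      nlinarith [norm_nonneg (psiLim z - 1)]
  · have h2' : ((√2 : ℝ) : ℂ) ^ 2 = 2 := by exact_mod_cast h2
    unfold psiLim
    push_cast
    linear_combination -h2' / 2

theorem isSharpRadius_psiNe {R : ℝ} (hR0 : 0 < R) (hR1 : R < 0.56)
    (hR : 2 * R ^ 3 - 6 * R + 3 = 0) : IsSharpRadius starCar (starClass psiNe) R := by
  have hre : ∀ z : ℂ, (psiNe z).re = 1 + z.re * (1 + z.im ^ 2) - z.re ^ 3 / 3 := by
    intro z
    have : psiNe z = 1 + z - (1 / 3 : ℝ) * z ^ 3 := by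
      unfold psiNe
      push_cast
      ring
    rw [this]
    rw [sub_re, add_re, one_re, re_ofReal_mul]
    simp only [pow_succ, pow_zero, one_mul, mul_re, mul_im]
    ring
  have hx : ∀ (z : ℂ) (r : ℝ), ‖z‖ < r → -r < z.re := fun z r hz => by
    have h4 := neg_abs_le z.re
    have h5 := Complex.abs_re_le_norm z
    linarith
  apply isSharpRadius_of_mapsTo
  · unfold psiNe
    fun_prop
  · simp [psiNe]
  · intro z hz
    have h1 := sq_add_sq_lt (mem_unitDisk.1 hz)
    have h2 := hx z 1 (mem_unitDisk.1 hz)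
    rw [hre]
    by_cases h0 : 0 ≤ z.re
    · have : z.re ^ 2 ≤ 1 := by nlinarith [sq_nonneg z.im]
      nlinarith [mul_nonneg h0 (sq_nonneg z.im)]
    · push Not at h0
      have h3 : z.re * (1 + (1 - z.re ^ 2)) ≤ z.re * (1 + z.im ^ 2) :=
        mul_le_mul_of_nonpos_left (by linarith) h0.le
      -- The point `-0.7` approximates the minimiser `-1/√2` of `1 + 2x - 4x³/3`.
      nlinarith [mul_nonneg (sq_nonneg (z.re + 0.7)) (by linarith : 0 ≤ z.re + 2),
        mul_nonneg (sq_nonneg (z.re + 0.7)) (by linarith : 0 ≤ -z.re), sq_nonneg (z.re + 0.7)]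
  · exact hR0
  · linarith
  · intro z hz
    have h1 := sq_add_sq_lt hz
    have h2 := hx z R hz
    apply mem_cardioidRegion_of_norm_sub_one
    · rw [hre]
      by_cases h0 : 0 ≤ z.re
      · have : z.re ^ 2 ≤ 1 := by nlinarith [sq_nonneg z.im]
        nlinarith [mul_nonneg h0 (sq_nonneg z.im)]
      · push Not at h0
        have h3 : z.re * (1 + (R ^ 2 - z.re ^ 2)) ≤ z.re * (1 + z.im ^ 2) :=
          mul_le_mul_of_nonpos_left (by linarith) h0.le
        -- The lower bound `1 + x(1 + R²) - 4x³/3` equals `1/2` at `x = -R` by the cubic; the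
        -- product is its excess over `1/2`. The second factor exceeds `1 - 3R²`, positive since `R
        -- < 0.56`.
        have h4 : 0 < (R + z.re) * (1 + R ^ 2 - 4 / 3 * (R ^ 2 - R * z.re + z.re ^ 2)) := by
          apply mul_pos (by linarith)
          nlinarith
        nlinarith
    · have h : psiNe z - 1 = z + (-1 / 3 : ℝ) * z ^ 3 := by
        unfold psiNe
        push_cast
        ring
      have h1 : ‖psiNe z - 1‖ ≤ 1 := by
        rw [h]
        refine (norm_add_le _ _).trans ?_
        rw [norm_mul, norm_pow, Complex.norm_real]
        norm_num
        have : ‖z‖ ^ 3 ≤ 1 := pow_le_one₀ (norm_nonneg _) (by linarith)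
        linarith
      nlinarith [norm_nonneg (psiNe z - 1)]
  · have hR' : 2 * (R : ℂ) ^ 3 - 6 * R + 3 = 0 := by exact_mod_cast hR
    unfold psiNe
    linear_combination hR' / 6

lemma exists_isLeast_cubic_root :
    ∃ r : ℝ, IsLeast {r : ℝ | 0 < r ∧ r < 1 ∧ 2 * r ^ 3 - 6 * r + 3 = 0} r ∧
      |r - 0.557875| < 0.000001 := by
  have hc : ContinuousOn (fun r : ℝ => 2 * r ^ 3 - 6 * r + 3) (Set.Icc 0.5578745 0.5578755) := by
    fun_prop
  obtain ⟨r, ⟨h1, h2⟩, hr⟩ := intermediate_value_Icc' (by norm_num) hc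
    (show (0 : ℝ) ∈ Set.Icc _ _ by constructor <;> norm_num)
  refine ⟨r, ⟨⟨by linarith, by linarith, hr⟩, ?_⟩, ?_⟩
  · rintro s ⟨hs0, hs1, hs⟩
    by_contra hlt
    push Not at hlt
    -- A second root would force `r² + rs + s² = 3`, impossible in `(0, 1)`.
    have h3 : (r - s) * (r ^ 2 + r * s + s ^ 2 - 3) = 0 := by
      linear_combination (hr - hs) / 2
    rcases mul_eq_zero.1 h3 with h | h <;> nlinarith
  · rw [abs_lt]
    constructor <;> linarith

/-! ### The sine class -/

lemma sin_re_eq (z : ℂ) : (sin z).re = Real.sin z.re * Real.cosh z.im := by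
  rw [Complex.sin_eq, ← ofReal_sin, ← ofReal_cos, ← ofReal_cosh, ← ofReal_sinh]
  simp only [add_re, mul_re, ofReal_re, ofReal_im, I_re, I_im, mul_im]
  ring

lemma sin_im_eq (z : ℂ) : (sin z).im = Real.cos z.re * Real.sinh z.im := by
  rw [Complex.sin_eq, ← ofReal_sin, ← ofReal_cos, ← ofReal_cosh, ← ofReal_sinh]
  simp only [add_im, mul_re, ofReal_re, ofReal_im, I_re, I_im, mul_im]
  ring

lemma abs_sin_mul_cosh_lt_one {x y : ℝ} (h : x ^ 2 + y ^ 2 < 1) :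
    |Real.sin x * Real.cosh y| < 1 := by
  have hx : |Real.sin x| ≤ |x| := Real.abs_sin_le_abs
  rw [abs_mul, abs_of_pos (Real.cosh_pos y)]
  refine (mul_le_mul hx (Real.cosh_le_exp_half_sq y) (Real.cosh_pos y).le (abs_nonneg x)).trans_lt ?_
  apply lt_of_pow_lt_pow_left₀ 2 zero_le_one
  rw [mul_pow, sq_abs, ← Real.exp_nat_mul]
  have h1 : Real.exp (((2 : ℕ) : ℝ) * (y ^ 2 / 2)) * Real.exp (-y ^ 2) = 1 := by
    rw [← Real.exp_add]
    simp
    ring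
  have h2 := Real.add_one_le_exp (-y ^ 2)
  have h3 := Real.exp_pos (((2 : ℕ) : ℝ) * (y ^ 2 / 2))
  nlinarith

/-- With `R = π/6`, comparison with `sin R = 1/2` gives `sin |x| ≤ (1 - (R² - x²)/2)/2 < (1 -
y²/2)/2 ≤ exp (-y²/2)/2`, while `cosh y ≤ exp (y²/2)`. -/
lemma abs_sin_mul_cosh_lt_half {x y : ℝ} (h : x ^ 2 + y ^ 2 < (Real.pi / 6) ^ 2) :
    |Real.sin x * Real.cosh y| < 1 / 2 := by
  obtain ⟨R, hR⟩ : ∃ R, R = Real.pi / 6 := ⟨_, rfl⟩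
  have hpi := Real.pi_gt_three
  have hpi' := Real.pi_lt_d2
  rw [← hR] at h
  have hR0 : 0 < R := by linarith
  have hR1 : R < 0.53 := by linarith
  have hxR : |x| < R := abs_lt_of_sq_lt_sq (by nlinarith [sq_nonneg y]) hR0.le
  have hx0 := abs_nonneg x
  have hsin : Real.sin |x| ≤ 1 / 2 * (1 - (R ^ 2 - x ^ 2) / 2) := by
    have h1 : Real.sin R - Real.sin |x| = 2 * Real.sin ((R - |x|) / 2) * Real.cos ((R + |x|) / 2) :=
      Real.sin_sub_sin R |x|
    have h2 : Real.sin R = 1 / 2 := by rw [hR, Real.sin_pi_div_six]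
    have h3 := Real.mul_le_sin (x := (R - |x|) / 2) (by linarith) (by linarith)
    have h4 := Real.one_sub_sq_div_two_le_cos (x := (R + |x|) / 2)
    have h5 : 0.6 ≤ 2 / Real.pi := by
      rw [le_div_iff₀ Real.pi_pos]
      linarith
    have h6 : 0.6 * ((R - |x|) / 2) ≤ Real.sin ((R - |x|) / 2) :=
      (mul_le_mul_of_nonneg_right h5 (by linarith)).trans h3
    have h7 : 0.8 ≤ Real.cos ((R + |x|) / 2) := by nlinarith
    have h8 : 0.6 * ((R - |x|) / 2) * 0.8 ≤
        Real.sin ((R - |x|) / 2) * Real.cos ((R + |x|) / 2) :=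
      mul_le_mul h6 h7 (by norm_num) (le_trans (by linarith) h6)
    have h9 : R ^ 2 - x ^ 2 = (R - |x|) * (R + |x|) := by
      rw [← sq_abs x]
      ring
    rw [h9]
    nlinarith
  have habs : |Real.sin x| = Real.sin |x| := by
    have h0 : 0 ≤ Real.sin |x| := Real.sin_nonneg_of_nonneg_of_le_pi hx0 (by linarith)
    rcases abs_choice x with hx | hx
    · rw [hx] at h0 ⊢
      exact abs_of_nonneg h0
    · rw [hx, Real.sin_neg] at h0 ⊢
      exact abs_of_nonpos (by linarith)
  rw [abs_mul, abs_of_pos (Real.cosh_pos y), habs]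
  have h1 : Real.exp (y ^ 2 / 2) * Real.exp (-(y ^ 2 / 2)) = 1 := by
    rw [← Real.exp_add]
    simp
  have h2 := Real.add_one_le_exp (-(y ^ 2 / 2))
  have h3 := Real.exp_pos (y ^ 2 / 2)
  calc Real.sin |x| * Real.cosh y
      ≤ 1 / 2 * (1 - (R ^ 2 - x ^ 2) / 2) * Real.exp (y ^ 2 / 2) := by
        apply mul_le_mul hsin (Real.cosh_le_exp_half_sq y) (Real.cosh_pos y).le
        nlinarith [sq_nonneg x]
    _ < 1 / 2 := by nlinarith

theorem isSharpRadius_psiSin :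
    IsSharpRadius starCar (starClass psiSin) (Real.arcsin (1 / 2)) := by
  have hpi := Real.pi_gt_three
  have hpi' := Real.pi_lt_d2
  have hR : Real.arcsin (1 / 2) = Real.pi / 6 := by
    rw [← Real.sin_pi_div_six, Real.arcsin_sin] <;> linarith
  rw [hR]
  apply isSharpRadius_of_mapsTo
  · unfold psiSin
    fun_prop
  · simp [psiSin]
  · intro z hz
    have h := sq_add_sq_lt (mem_unitDisk.1 hz)
    rw [one_pow] at h
    have := (abs_lt.1 (abs_sin_mul_cosh_lt_one h)).1
    rw [psiSin, add_re, one_re, sin_re_eq]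
    linarith
  · linarith
  · linarith
  · intro z hz
    have h := sq_add_sq_lt hz
    obtain ⟨h1, h2⟩ := abs_lt.1 (abs_sin_mul_cosh_lt_half h)
    apply mem_cardioidRegion_of_norm_sub_one
    · rw [psiSin, add_re, one_re, sin_re_eq]
      linarith
    · have him : (psiSin z).im = Real.cos z.re * Real.sinh z.im := by
        rw [psiSin, add_im, one_im, zero_add, sin_im_eq]
      rw [norm_sub_one_sq, him, psiSin, add_re, one_re, sin_re_eq]
      -- Hence `sinh² ≤ 1`, and `‖sin z‖ ^ 2` is at most `1/4 + 1`, exactly the allowed `5/4`.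
      have hc : Real.cosh z.im ^ 2 ≤ 2 := by
        have hy : z.im ^ 2 < 0.3 := by nlinarith [sq_nonneg z.re]
        have h3 := Real.cosh_le_exp_half_sq z.im
        have h4 : Real.exp (z.im ^ 2 / 2) * Real.exp (-(z.im ^ 2 / 2)) = 1 := by
          rw [← Real.exp_add]
          simp
        have h5 := Real.add_one_le_exp (-(z.im ^ 2 / 2))
        have h6 : Real.exp (z.im ^ 2 / 2) ≤ 1.2 := by
          nlinarith [Real.exp_pos (z.im ^ 2 / 2)]
        nlinarith [Real.cosh_pos z.im]
      have hs : Real.sinh z.im ^ 2 ≤ 1 := by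
        have := Real.cosh_sq z.im
        linarith
      have hcos : Real.cos z.re ^ 2 ≤ 1 := Real.cos_sq_le_one _
      rw [mul_pow]
      nlinarith [mul_le_mul hcos hs (sq_nonneg _) zero_le_one]
  · rw [psiSin, Complex.sin_neg, ← ofReal_sin, Real.sin_pi_div_six]
    push_cast
    norm_num

/-! ### The exponential class -/

lemma exp_neg_le_quadratic {s : ℝ} (hs : 0 ≤ s) : Real.exp (-s) ≤ 1 - s + s ^ 2 / 2 := by
  have h1 := Real.quadratic_le_exp_of_nonneg hs
  have h2 : Real.exp s * Real.exp (-s) = 1 := by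
    rw [← Real.exp_add]
    simp
  have h3 := Real.exp_pos (-s)
  have h4 : (1 + s + s ^ 2 / 2) * (1 - s + s ^ 2 / 2) = 1 + s ^ 4 / 4 := by ring
  have h5 : 0 < 1 - s + s ^ 2 / 2 := by nlinarith [sq_nonneg (s - 1)]
  by_contra hlt
  push Not at hlt
  have := mul_lt_mul'' (lt_of_lt_of_le (by positivity) h1) hlt (by positivity) h5.le
  nlinarith [pow_nonneg hs 4]

/-- Let `s = ‖z‖ + z.re`, so `z.im ^ 2 = s * (2 * ‖z‖ - s)`. Then `exp (-s) ≤ 1 - s + s²/2 ≤ 1 -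
z.im²/2 ≤ cos z.im`, the middle step being `‖z‖ ≤ 1`. -/
lemma exp_neg_norm_le_re_exp {z : ℂ} (hz : ‖z‖ ≤ 1) : Real.exp (-‖z‖) ≤ (exp z).re := by
  have hs : 0 ≤ ‖z‖ + z.re := by
    linarith [neg_abs_le z.re, Complex.abs_re_le_norm z]
  have hsq : ‖z‖ ^ 2 = z.re ^ 2 + z.im ^ 2 := by
    rw [Complex.sq_norm, normSq_apply]
    ring
  have h1 := exp_neg_le_quadratic hs
  have h2 := Real.one_sub_sq_div_two_le_cos (x := z.im)
  have h3 : Real.exp (-(‖z‖ + z.re)) ≤ Real.cos z.im := by nlinarith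
  calc Real.exp (-‖z‖) = Real.exp z.re * Real.exp (-(‖z‖ + z.re)) := by
        rw [← Real.exp_add]
        ring_nf
    _ ≤ Real.exp z.re * Real.cos z.im := by gcongr
    _ = (exp z).re := (Complex.exp_re z).symm

lemma norm_exp_sub_one_le_exp_norm (z : ℂ) : ‖exp z - 1‖ ≤ Real.exp ‖z‖ - 1 := by
  have := Complex.norm_exp_sub_sum_le_exp_norm_sub_sum z 1
  simpa using this

lemma exp_quadratic_bound {x : ℝ} (hx : x ≤ 1) :
    0.8 * Real.exp x - 0.1625 * Real.exp (-x) < 1.075 * (1 + x ^ 2) := by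
  rcases le_total x 0 with h | h
  · have : Real.exp x ≤ 1 := Real.exp_le_one_iff.2 h
    nlinarith [Real.exp_pos (-x), sq_nonneg x]
  · have h1 := Real.exp_bound' h hx (n := 5) (by norm_num)
    simp only [Finset.sum_range_succ, Finset.sum_range_zero, Nat.factorial] at h1
    norm_num at h1
    have h2 : 0.3678 * (2 - x) ≤ Real.exp (-x) := by
      have h3 := Real.add_one_le_exp (1 - x)
      have h4 := Real.exp_neg_one_gt_d9
      have h5 : Real.exp (-x) = Real.exp (-1) * Real.exp (1 - x) := by
        rw [← Real.exp_add]
        ring_nf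
      rw [h5]
      apply mul_le_mul <;> linarith [Real.exp_pos (-1)]
    have h4 : x ^ 4 ≤ x ^ 3 := pow_le_pow_of_le_one h hx (by norm_num)
    have h5 : x ^ 5 ≤ x ^ 3 := pow_le_pow_of_le_one h hx (by norm_num)
    nlinarith [mul_nonneg h (sub_nonneg.2 hx), mul_nonneg (sq_nonneg x) (sub_nonneg.2 hx),
      mul_nonneg (sub_nonneg.2 hx) (sq_nonneg (1 - x))]

/-- Eliminating `E ^ 2` leaves a gap that factors as `(0.45 - t) * (C + 9 - 5 * (t + 0.45))`; the
constants `0.1625` and `2.15` make it vanish at `t = 0.45`. -/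
lemma exp_class_quadratic {E C t : ℝ} (hC : 0 ≤ C) (ht : t ≤ 0.45)
    (h : 0.8 * E ^ 2 - 0.1625 < 2.15 * C) :
    0.8 * (E ^ 2 - 2 * C + 1 - 5 * (1 - t) ^ 2) < (C - t) * (1 - t) := by
  have h2 : 0 ≤ (0.45 - t) * (C + 9 - 5 * (t + 0.45)) := by
    apply mul_nonneg <;> linarith
  linarith

lemma one_add_mul_exp_sub_one_mem {R k : ℝ} (hR0 : 0 < R) (hR1 : R ≤ 1)
    (hk : 2 * k * (1 - Real.exp (-R)) = 1) {z : ℂ} (hz : ‖z‖ < R) :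
    1 + k * (exp z - 1) ∈ cardioidRegion := by
  obtain ⟨t, ht⟩ : ∃ t, t = Real.exp (-R) := ⟨_, rfl⟩
  have ht0 : 0 < t := ht ▸ Real.exp_pos _
  have ht1 : t < 1 := by
    rw [ht]
    simpa using hR0
  have hte : 0.3678 < t := by
    have : Real.exp (-1) ≤ t := by
      rw [ht]
      gcongr
    linarith [Real.exp_neg_one_gt_d9]
  have hRt : Real.exp R * t = 1 := by
    rw [ht, ← Real.exp_add]
    simp
  rw [← ht] at hk
  have hk0 : 0 < k := by
    by_contra h
    nlinarith
  have hre : (1 + (k : ℂ) * (exp z - 1)).re = 1 + k * ((exp z).re - 1) := by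
    rw [add_re, one_re, re_ofReal_mul, sub_re, one_re]
  have hC : t < (exp z).re := by
    refine lt_of_lt_of_le ?_ (exp_neg_norm_le_re_exp (hz.le.trans hR1))
    rw [ht]
    gcongr
  have hhalf : 1 / 2 < (1 + (k : ℂ) * (exp z - 1)).re := by
    rw [hre]
    nlinarith
  have hnorm : ‖1 + (k : ℂ) * (exp z - 1) - 1‖ = k * ‖exp z - 1‖ := by
    rw [add_sub_cancel_left, norm_mul, Complex.norm_real, Real.norm_of_nonneg hk0.le]
  -- Because `k * (exp R - 1) = k * (1 - t) / t = 1 / (2 * t)`.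
  have hD : 2 * (k * ‖exp z - 1‖) * t ≤ 1 := by
    have h1 := norm_exp_sub_one_le_exp_norm z
    have h2 : Real.exp ‖z‖ ≤ Real.exp R := Real.exp_le_exp.2 hz.le
    have h3 : ‖exp z - 1‖ * t ≤ 1 - t := by nlinarith
    nlinarith
  have hD0 : 0 ≤ k * ‖exp z - 1‖ := by positivity
  by_cases hbig : 4 * (k * ‖exp z - 1‖) ^ 2 ≤ 5
  · refine mem_cardioidRegion_of_norm_sub_one hhalf ?_
    rw [hnorm]
    linarith
  push Not at hbig
  have ht45 : t ≤ 0.45 := by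
    by_contra h
    push Not at h
    have : k * ‖exp z - 1‖ ≤ 1.1115 := by nlinarith
    nlinarith
  apply mem_cardioidRegion_of_quartic
  rw [hnorm, hre]
  have hup : k * ‖exp z - 1‖ ≤ 1.3595 := by nlinarith
  have h639 : 4 * (k * ‖exp z - 1‖) ^ 2 ≤ 7.4 := by nlinarith
  -- The quartic's first factor is at most `7.4 - 1 = 8 * 0.8`, where `7.4` comes from `t > 0.3678`
  -- (as `R ≤ 1`).
  suffices h : 0.8 * (4 * (k * ‖exp z - 1‖) ^ 2 - 5) < 1 + 2 * k * ((exp z).re - 1) by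
    nlinarith
  have hQ : ‖exp z - 1‖ ^ 2 = Real.exp z.re ^ 2 - 2 * (exp z).re + 1 := by
    have h1 : Real.exp z.re ^ 2 = (exp z).re ^ 2 + (exp z).im ^ 2 := by
      rw [← Complex.norm_exp, Complex.sq_norm, normSq_apply]
      ring
    rw [norm_sub_one_sq, h1]
    ring
  have hx1 : z.re ≤ 1 := (Complex.re_le_norm z).trans (hz.le.trans hR1)
  have hE := Real.exp_pos z.re
  have hCE : Real.exp z.re * ((1 + z.re ^ 2) / 2) ≤ (exp z).re := by
    rw [Complex.exp_re]
    have h1 := Real.one_sub_sq_div_two_le_cos (x := z.im)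
    have h2 := sq_add_sq_lt hz
    gcongr
    nlinarith
  have hB := mul_lt_mul_of_pos_right (exp_quadratic_bound hx1) hE
  have hEE : Real.exp (-z.re) * Real.exp z.re = 1 := by
    rw [← Real.exp_add]
    simp
  -- This is the target multiplied by `(1 - t) ^ 2`, using `2 * k * (1 - t) = 1`.
  have key : 0.8 * (Real.exp z.re ^ 2 - 2 * (exp z).re + 1 - 5 * (1 - t) ^ 2) <
      ((exp z).re - t) * (1 - t) := by
    apply exp_class_quadratic (ht0.trans hC).le ht45
    have h1 : (0.8 * Real.exp z.re - 0.1625 * Real.exp (-z.re)) * Real.exp z.re =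
        0.8 * Real.exp z.re ^ 2 - 0.1625 := by
      linear_combination -0.1625 * hEE
    rw [h1] at hB
    linarith
  rw [mul_pow, hQ]
  have h4 : (2 * k) ^ 2 * (1 - t) ^ 2 = 1 := by
    rw [← mul_pow, hk, one_pow]
  have h5 := mul_lt_mul_of_pos_left key (show 0 < (2 * k) ^ 2 by positivity)
  have h6 : (2 * k) ^ 2 * (((exp z).re - t) * (1 - t)) = 2 * k * ((exp z).re - t) := by
    linear_combination 2 * k * ((exp z).re - t) * hk
  have h7 : (2 * k) ^ 2 * (0.8 * (Real.exp z.re ^ 2 - 2 * (exp z).re + 1 - 5 * (1 - t) ^ 2)) =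
      0.8 * (4 * (k ^ 2 * (Real.exp z.re ^ 2 - 2 * (exp z).re + 1)) - 5) := by
    linear_combination -4 * h4
  rw [h6, h7] at h5
  linarith

theorem isSharpRadius_psiE {α : ℝ} (hα : 0 ≤ α)
    (hα1 : α < (Real.exp 1 - 2) / (2 * (Real.exp 1 - 1))) :
    IsSharpRadius starCar (starClass (psiE α)) (Real.log (2 * (1 - α) / (1 - 2 * α))) := by
  have he := Real.exp_one_gt_d9
  rw [lt_div_iff₀ (by linarith)] at hα1
  have hα2 : 0 < 1 - 2 * α := by nlinarith
  have hk : 0 < 1 - α := by linarith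
  have hq : 0 < 2 * (1 - α) / (1 - 2 * α) := by positivity
  have hψ : ∀ z, psiE α z = 1 + ((1 - α : ℝ) : ℂ) * (exp z - 1) := by
    intro z
    unfold psiE
    push_cast
    ring
  obtain ⟨R, hR⟩ : ∃ R, R = Real.log (2 * (1 - α) / (1 - 2 * α)) := ⟨_, rfl⟩
  have hexp : Real.exp (-R) = (1 - 2 * α) / (2 * (1 - α)) := by
    rw [hR, Real.exp_neg, Real.exp_log hq, inv_div]
  have hR0 : 0 < R := by
    rw [hR]
    apply Real.log_pos
    rw [one_lt_div hα2]
    linarith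
  have hR1 : R ≤ 1 := by
    rw [hR, Real.log_le_iff_le_exp hq, div_le_iff₀ hα2]
    linarith
  rw [← hR]
  apply isSharpRadius_of_mapsTo _ _ _ hR0 hR1
  · intro z hz
    rw [hψ]
    refine one_add_mul_exp_sub_one_mem hR0 hR1 ?_ hz
    rw [hexp]
    field_simp
    ring
  · have hk' : (1 - (α : ℂ)) ≠ 0 := by exact_mod_cast hk.ne'
    have h : exp (-(R : ℂ)) = (1 - 2 * α) / (2 * (1 - α)) := by
      exact_mod_cast congrArg ((↑) : ℝ → ℂ) hexp
    rw [psiE, h]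
    field_simp
    ring
  · unfold psiE
    fun_prop
  · simp [psiE]
  · intro z hz
    have := (Real.exp_pos _).trans_le (exp_neg_norm_le_re_exp (mem_unitDisk.1 hz).le)
    rw [hψ, add_re, one_re, re_ofReal_mul, sub_re, one_re]
    nlinarith

end CarRadius

theorem theorem4p3 :
    (∀ c : ℝ, 3 / 4 < c → c ≤ 1 →
      CarRadius.IsSharpRadius CarRadius.starCar
        (CarRadius.starClass (CarRadius.psiCassini c)) (3 / (4 * c))) ∧
    (∀ α : ℝ, 0 ≤ α → α < 1 / 2 →
      CarRadius.IsSharpRadius CarRadius.starCar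
        (CarRadius.starClass (CarRadius.psiL α)) ((3 - 4 * α) / (4 * (1 - α) ^ 2))) ∧
    (∀ α : ℝ, 0 ≤ α → α < (Real.exp 1 - 2) / (2 * (Real.exp 1 - 1)) →
      CarRadius.IsSharpRadius CarRadius.starCar
        (CarRadius.starClass (CarRadius.psiE α))
        (Real.log (2 * (1 - α) / (1 - 2 * α)))) ∧
    CarRadius.IsSharpRadius CarRadius.starCar
      (CarRadius.starClass CarRadius.psiRL) ((39 + 17 * √2) / 82) ∧
    CarRadius.IsSharpRadius CarRadius.starCar
      (CarRadius.starClass CarRadius.psiC) (1 / 2) ∧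
    CarRadius.IsSharpRadius CarRadius.starCar
      (CarRadius.starClass CarRadius.psiLim) (√2 - 1) ∧
    CarRadius.IsSharpRadius CarRadius.starCar
      (CarRadius.starClass CarRadius.psiCrescent) (3 / 4) ∧
    CarRadius.IsSharpRadius CarRadius.starCar
      (CarRadius.starClass CarRadius.psiSin) (Real.arcsin (1 / 2)) ∧
    (∃ r₉ : ℝ, IsLeast {r : ℝ | 0 < r ∧ r < 1 ∧ 2 * r ^ 3 - 6 * r + 3 = 0} r₉ ∧
      |r₉ - 0.557875| < 0.000001 ∧
      CarRadius.IsSharpRadius CarRadius.starCar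
        (CarRadius.starClass CarRadius.psiNe) r₉) := by
  obtain ⟨r, hr, hr'⟩ := CarRadius.exists_isLeast_cubic_root
  exact ⟨fun _ => CarRadius.isSharpRadius_psiCassini, fun _ => CarRadius.isSharpRadius_psiL,
    fun _ => CarRadius.isSharpRadius_psiE, CarRadius.isSharpRadius_psiRL,
    CarRadius.isSharpRadius_psiC, CarRadius.isSharpRadius_psiLim,
    CarRadius.isSharpRadius_psiCrescent, CarRadius.isSharpRadius_psiSin, r, hr, hr',
    CarRadius.isSharpRadius_psiNe hr.1.1 (by linarith [(abs_lt.1 hr').2]) hr.1.2.2⟩
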